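/- Let $d\ge 1$ and let $\Omega\subset\mathbb R^d$ be a bounded domain with $C^1$ boundary. Let $J\in C(\mathbb R^d)$ satisfy $J(0)>0$ and $0\le J(z)\le C e^{-|z|^{1+\beta}}$ for all $z\in\mathbb R^d$, with some $C,\beta>0$; let $\kappa\in C(\overline\Omega\times\overline\Omega\times\mathbb T^d\times\mathbb T^d)$ with $\kappa>0$, and $a\in C(\overline\Omega\times\mathbb T^d)$, where $\mathbb T^d=\mathbb R^d/\mathbb Z^d$ and functions on $\mathbb T^d$ are identified with $\mathbb Z^d$-periodic functions on $\mathbb R^d$. For $\varepsilon>0$ put $$\mathcal L_\varepsilon\rho(x)=-\frac1{\varepsilon^d}\int_\Omega J\Bigl(\frac{x-y}{\varepsilon}\Bigr)\kappa\Bigl(x,y,\frac x\varepsilon,\frac y\varepsilon\Bigr)\rho(y)\,dy+a\Bigl(x,\frac x\varepsilon\Bigr)\rho(x),$$ $$\lambda_\varepsilon=\sup\bigl\{\lambda\in\mathbb R \;:\; \exists\, v\in C(\overline\Omega),\ v>0 \text{ on } \overline\Omega,\ \mathcal L_\varepsilon v\ge\lambda v\ \text{in}\ \Omega\bigr\}.$$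 Let $\varepsilon$ tend to $0$ through positive values, either through all of them or along a subsequence. Suppose that for all sufficiently small such $\varepsilon$ the number $\lambda_\varepsilon$ is an eigenvalue of $\mathcal L_\varepsilon$ with a positive eigenfunction $e^{-W_\varepsilon/\varepsilon}$, where $W_\varepsilon\in C(\overline\Omega)$, that is, $\mathcal L_\varepsilon e^{-W_\varepsilon/\varepsilon}=\lambda_\varepsilon e^{-W_\varepsilon/\varepsilon}$ in $\Omega$, normalised by $$\int_{\Omega'}W_\varepsilon(x)\,dx=0,$$ where $\Omega'$ is a fixed (non-empty) domain with $\overline{\Omega'}\subset\Omega$. Then the half-relaxed upper limit $$W^*(x)=\lim_{r\to0}\ \limsup_{\varepsilon\to0}\ \sup\{W_\varepsilon(\xi)\;:\;\xi\in B_r(x)\cap\Omega\}$$ exists and is finite at every $x\in\Omega$, and $W^*$ is a bounded function in $\Omega$ (bounded from above and from below). -/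

import Mathlib

open MeasureTheory Filter Topology Set

noncomputable section

namespace NonlocalSpectral

/-- `ℝ^d` with the Euclidean norm. -/
abbrev Rn (d : ℕ) : Type := EuclideanSpace ℝ (Fin d)

/-- A domain: a non-empty connected open set (`IsConnected` includes non-emptiness). -/
structure IsDomainIn {d : ℕ} (Ω : Set (Rn d)) : Prop where
  isOpen : IsOpen Ω
  isConnected : IsConnected Ω

/-- A bounded domain with `C¹` boundary: near each boundary point the domain is the sublevel set
`{ψ < 0}` of a `C¹` function `ψ` whose differential does not vanish at that point. -/
structure IsBoundedC1Domain {d : ℕ} (Ω : Set (Rn d)) : Prop extends IsDomainIn Ω where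
  isBounded : Bornology.IsBounded Ω
  c1_boundary : ∀ x ∈ frontier Ω, ∃ (U : Set (Rn d)) (ψ : Rn d → ℝ),
    IsOpen U ∧ x ∈ U ∧ ContDiffOn ℝ 1 ψ U ∧ fderiv ℝ ψ x ≠ 0 ∧ ∀ y ∈ U, (y ∈ Ω ↔ ψ y < 0)

/-- The assumptions on the dispersal kernel `J`: it is continuous, `J 0 > 0`, and
`0 ≤ J z ≤ C exp (-|z|^(1+β))` for some `C, β > 0`. -/
structure IsDispersalKernel {d : ℕ} (J : Rn d → ℝ) : Prop where
  continuous : Continuous J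
  pos_zero : 0 < J 0
  nonneg : ∀ z, 0 ≤ J z
  decay : ∃ C β : ℝ, 0 < C ∧ 0 < β ∧ ∀ z, J z ≤ C * Real.exp (-(‖z‖ ^ (1 + β)))

/-- The vector of `ℝ^d` with the integer coordinates `k`. -/
def latticeVec {d : ℕ} (k : Fin d → ℤ) : Rn d := WithLp.toLp 2 (fun i => (k i : ℝ))

/-- A function on `ℝ^d` is `ℤ^d`-periodic, i.e. is a function on the torus `ℝ^d / ℤ^d`. -/
def IsPeriodic {d : ℕ} (f : Rn d → ℝ) : Prop :=
  ∀ (k : Fin d → ℤ) (ξ : Rn d), f (ξ + latticeVec k) = f ξ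

/-- `κ ∈ C(Ω̄ × Ω̄ × 𝕋^d × 𝕋^d)` and `κ > 0`. Functions on the torus are periodic functions. -/
structure IsAdmissibleKappa {d : ℕ} (Ω : Set (Rn d))
    (κ : Rn d → Rn d → Rn d → Rn d → ℝ) : Prop where
  continuousOn : ContinuousOn
    (fun q : Rn d × Rn d × Rn d × Rn d => κ q.1 q.2.1 q.2.2.1 q.2.2.2)
    (closure Ω ×ˢ (closure Ω ×ˢ (univ ×ˢ univ)))
  periodic_left : ∀ x ∈ closure Ω, ∀ y ∈ closure Ω, ∀ η, IsPeriodic (fun ξ => κ x y ξ η)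
  periodic_right : ∀ x ∈ closure Ω, ∀ y ∈ closure Ω, ∀ ξ, IsPeriodic (fun η => κ x y ξ η)
  pos : ∀ x ∈ closure Ω, ∀ y ∈ closure Ω, ∀ ξ η, 0 < κ x y ξ η

/-- `a ∈ C(Ω̄ × 𝕋^d)`. -/
structure IsAdmissiblePotential {d : ℕ} (Ω : Set (Rn d)) (a : Rn d → Rn d → ℝ) : Prop where
  continuousOn : ContinuousOn (fun q : Rn d × Rn d => a q.1 q.2) (closure Ω ×ˢ univ)
  periodic : ∀ x ∈ closure Ω, IsPeriodic (a x)

/-- The nonlocal operator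
`(L_ε ρ)(x) = -ε^{-d} ∫_Ω J((x-y)/ε) κ(x, y, x/ε, y/ε) ρ(y) dy + a(x, x/ε) ρ(x)`. -/
def nonlocalOp {d : ℕ} (Ω : Set (Rn d)) (J : Rn d → ℝ) (κ : Rn d → Rn d → Rn d → Rn d → ℝ)
    (a : Rn d → Rn d → ℝ) (ε : ℝ) (ρ : Rn d → ℝ) (x : Rn d) : ℝ :=
  -(1 / ε ^ d) * (∫ y in Ω, J (ε⁻¹ • (x - y)) * κ x y (ε⁻¹ • x) (ε⁻¹ • y) * ρ y)
    + a x (ε⁻¹ • x) * ρ x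

/-- `λ_ε = sup {λ | ∃ v ∈ C(Ω̄), v > 0, L_ε v ≥ λ v in Ω}`. -/
def bottomPoint {d : ℕ} (Ω : Set (Rn d)) (J : Rn d → ℝ) (κ : Rn d → Rn d → Rn d → Rn d → ℝ)
    (a : Rn d → Rn d → ℝ) (ε : ℝ) : ℝ :=
  sSup {lam : ℝ | ∃ v : Rn d → ℝ, ContinuousOn v (closure Ω) ∧ (∀ x ∈ closure Ω, 0 < v x) ∧
    ∀ x ∈ Ω, lam * v x ≤ nonlocalOp Ω J κ a ε v x}

/-- `W ∈ C(Ω̄)` and `e^{-W/ε}` is an eigenfunction of `L_ε` with eigenvalue `λ_ε`. -/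
structure IsLogEigenfunction {d : ℕ} (Ω : Set (Rn d)) (J : Rn d → ℝ)
    (κ : Rn d → Rn d → Rn d → Rn d → ℝ) (a : Rn d → Rn d → ℝ) (ε : ℝ) (W : Rn d → ℝ) :
    Prop where
  continuousOn : ContinuousOn W (closure Ω)
  eigen : ∀ x ∈ Ω, nonlocalOp Ω J κ a ε (fun y => Real.exp (-(W y / ε))) x
    = bottomPoint Ω J κ a ε * Real.exp (-(W x / ε))

/-- `limsup_{ε → 0} sup {W_ε(ξ) | ξ ∈ B_r(x) ∩ Ω}`, with values in `[-∞, ∞]`. The filter `l`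
records how `ε` tends to `0` (all `ε`, or a subsequence). -/
def relaxedSup {d : ℕ} (Ω : Set (Rn d)) (l : Filter ℝ) (W : ℝ → Rn d → ℝ) (x : Rn d) (r : ℝ) :
    EReal :=
  limsup (fun ε => ⨆ ξ ∈ Metric.ball x r ∩ Ω, (W ε ξ : EReal)) l

end NonlocalSpectral

end

noncomputable section

namespace NonlocalSpectral

section Geometry

variable {E : Type*} [NormedAddCommGroup E] [NormedSpace ℝ E]

/-- `y` can be reached from `x` by a polygonal path in `Ω` of length at most `L`. -/
inductive PolyReach (Ω : Set E) (x : E) : E → ℝ → Prop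
  | refl {L : ℝ} (hx : x ∈ Ω) (hL : 0 ≤ L) : PolyReach Ω x x L
  | step {y z : E} {L L' : ℝ} (h : PolyReach Ω x y L) (hs : segment ℝ y z ⊆ Ω)
      (hL : L + dist y z ≤ L') : PolyReach Ω x z L'

theorem PolyReach.mono {Ω : Set E} {x y : E} {L L' : ℝ} (h : PolyReach Ω x y L) (hL : L ≤ L') :
    PolyReach Ω x y L' := by
  cases h with
  | refl hx h0 => exact .refl hx (h0.trans hL)
  | step h hs h0 => exact .step h hs (h0.trans hL)

theorem PolyReach.left_mem {Ω : Set E} {x y : E} {L : ℝ} (h : PolyReach Ω x y L) : x ∈ Ω := by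
  induction h with
  | refl hx h0 => exact hx
  | step h hs h0 ih => exact ih

theorem PolyReach.trans {Ω : Set E} {x y z : E} {L M : ℝ} (h : PolyReach Ω x y L)
    (h' : PolyReach Ω y z M) : PolyReach Ω x z (L + M) := by
  induction h' with
  | refl hx h0 => exact h.mono (by linarith)
  | step h hs h0 ih => exact .step ih hs (by linarith)

theorem PolyReach.of_segment {Ω : Set E} {x y : E} (h : segment ℝ x y ⊆ Ω) :
    PolyReach Ω x y (dist x y) :=
  .step (.refl (h (left_mem_segment ℝ x y)) le_rfl) h (by simp)

theorem PolyReach.symm {Ω : Set E} {x y : E} {L : ℝ} (h : PolyReach Ω x y L) :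
    PolyReach Ω y x L := by
  induction h with
  | refl hx h0 => exact .refl hx h0
  | @step y z L L' h hs h0 ih =>
    have h1 : PolyReach Ω z y (dist z y) := .of_segment (by rwa [segment_symm])
    exact (h1.trans ih).mono (by rw [dist_comm]; linarith)

theorem exists_polyReach {Ω : Set E} (ho : IsOpen Ω) (hc : IsPreconnected Ω) {x y : E}
    (hx : x ∈ Ω) (hy : y ∈ Ω) : ∃ L, PolyReach Ω x y L := by
  refine hc.induction₂ (fun x y => ∃ L, PolyReach Ω x y L) ?_ ?_ ?_ hx hy
  · intro x hx
    obtain ⟨r, hr, hb⟩ := Metric.isOpen_iff.1 ho x hx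
    filter_upwards [mem_nhdsWithin_of_mem_nhds (Metric.ball_mem_nhds x hr)] with y hy
    exact ⟨_, .of_segment (((convex_ball x r).segment_subset (Metric.mem_ball_self hr) hy).trans hb)⟩
  · rintro x y z - - - ⟨L, h⟩ ⟨M, h'⟩
    exact ⟨_, h.trans h'⟩
  · rintro x y - - ⟨L, h⟩
    exact ⟨_, h.symm⟩

/-- Near a boundary point of `C¹` type, all points of `Ω` can be joined to one point of `Ω`
by polygonal paths of bounded length. -/
theorem exists_nhds_polyReach_of_c1 {Ω : Set E} {p : E} (hp : p ∈ closure Ω)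
    {U : Set E} {ψ : E → ℝ} (hU : IsOpen U) (hpU : p ∈ U) (hψ : ContDiffOn ℝ 1 ψ U)
    (hd : fderiv ℝ ψ p ≠ 0) (hΩ : ∀ y ∈ U, (y ∈ Ω ↔ ψ y < 0)) :
    ∃ q L, ∃ V ∈ 𝓝 p, ∀ x ∈ V ∩ Ω, PolyReach Ω q x L := by
  obtain ⟨v, hv⟩ : ∃ v, fderiv ℝ ψ p v < 0 := by
    obtain ⟨v, hv⟩ : ∃ v, fderiv ℝ ψ p v ≠ 0 := by
      by_contra! h
      exact hd (ContinuousLinearMap.ext h)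
    rcases lt_or_gt_of_ne hv with h | h
    · exact ⟨v, h⟩
    · exact ⟨-v, by simpa using h⟩
  have hψc : ContinuousAt ψ p := (hψ.continuousOn).continuousAt (hU.mem_nhds hpU)
  have hp0 : ψ p ≤ 0 := by
    by_contra! h
    have h1 : ∀ᶠ y in 𝓝 p, 0 < ψ y ∧ y ∈ U :=
      (hψc.eventually (lt_mem_nhds h)).and (hU.mem_nhds hpU)
    obtain ⟨y, hy, hyΩ⟩ := mem_closure_iff_nhds.1 hp _ h1
    exact absurd ((hΩ y hy.2).1 hyΩ) (not_lt.2 hy.1.le)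
  set m : ℝ := fderiv ℝ ψ p v / 2 with hm
  have hm0 : m < 0 := by linarith
  have hfc : ContinuousAt (fun z => fderiv ℝ ψ z v) p :=
    (((hψ.continuousOn_fderiv_of_isOpen hU le_rfl).continuousAt (hU.mem_nhds hpU))).clm_apply
      continuousAt_const
  have hev : ∀ᶠ z in 𝓝 p, fderiv ℝ ψ z v < m ∧ z ∈ U :=
    (hfc.eventually (gt_mem_nhds (by linarith))).and (hU.mem_nhds hpU)
  obtain ⟨R, hR, hball⟩ := Metric.mem_nhds_iff.1 hev
  obtain ⟨t, ht, htR⟩ : ∃ t : ℝ, 0 < t ∧ t * ‖v‖ < R / 2 := by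
    refine ⟨R / 2 / (‖v‖ + 1), by positivity, ?_⟩
    rw [div_mul_eq_mul_div, div_lt_iff₀ (by positivity)]
    nlinarith [norm_nonneg v]
  -- the directional decrease of `ψ`
  have key : ∀ x ∈ Metric.ball p (R / 2), ∀ s ∈ Icc (0 : ℝ) t,
      x + s • v ∈ U ∧ ψ (x + s • v) ≤ ψ x + m * s := by
    intro x hx s hs
    have hmem : ∀ s ∈ Icc (0 : ℝ) t, x + s • v ∈ Metric.ball p R := by
      intro s hs
      rw [Metric.mem_ball, dist_eq_norm] at hx ⊢
      calc ‖x + s • v - p‖ = ‖(x - p) + s • v‖ := by congr 1; abel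
        _ ≤ ‖x - p‖ + ‖s • v‖ := norm_add_le _ _
        _ < R / 2 + R / 2 := by
          have : ‖s • v‖ ≤ t * ‖v‖ := by
            rw [norm_smul, Real.norm_of_nonneg hs.1]
            gcongr
            exact hs.2
          linarith
        _ = R := by ring
    have hder : ∀ s ∈ Icc (0 : ℝ) t,
        HasDerivAt (fun s : ℝ => ψ (x + s • v)) (fderiv ℝ ψ (x + s • v) v) s := by
      intro s hs
      have hz := (hball (hmem s hs)).2
      have h1 : HasFDerivAt ψ (fderiv ℝ ψ (x + s • v)) (x + s • v) :=
        ((hψ.differentiableOn one_ne_zero).differentiableAt (hU.mem_nhds hz)).hasFDerivAt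
      have h2 : HasDerivAt (fun s : ℝ => x + s • v) v s := by
        simpa using ((hasDerivAt_id s).smul_const v).const_add x
      exact h1.comp_hasDerivAt s h2
    refine ⟨(hball (hmem s hs)).2, ?_⟩
    have := (convex_Icc (0 : ℝ) t).image_sub_le_mul_sub_of_deriv_le
      (f := fun s : ℝ => ψ (x + s • v)) (C := m)
      (fun s hs => (hder s hs).continuousAt.continuousWithinAt)
      (fun s hs => (hder s (interior_subset hs)).differentiableAt.differentiableWithinAt)
      (fun s hs => by
        rw [(hder s (interior_subset hs)).deriv]
        exact (hball (hmem s (interior_subset hs))).1.le)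
      0 ⟨le_rfl, ht.le⟩ s hs hs.1
    simp only [zero_smul, add_zero, sub_zero] at this
    linarith
  have hsmall : ∀ᶠ z in 𝓝 p, ψ z < -(m * t) :=
    hψc.eventually (gt_mem_nhds (by nlinarith))
  obtain ⟨r, hr, hrb⟩ := Metric.mem_nhds_iff.1 hsmall
  refine ⟨p + t • v, min r (R / 2) + t * ‖v‖, Metric.ball p (min r (R / 2)),
    Metric.ball_mem_nhds _ (by positivity), ?_⟩
  rintro x ⟨hx, hxΩ⟩
  have hxr : x ∈ Metric.ball p r := Metric.ball_subset_ball (min_le_left _ _) hx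
  have hxR : x ∈ Metric.ball p (R / 2) := Metric.ball_subset_ball (min_le_right _ _) hx
  have hxU : x ∈ U := by
    have := (key x hxR 0 ⟨le_rfl, ht.le⟩).1
    simpa using this
  have hs1 : segment ℝ (p + t • v) (x + t • v) ⊆ Ω := by
    rw [segment_eq_image']
    rintro _ ⟨s, hs, rfl⟩
    have hy : p + s • (x - p) ∈ Metric.ball p (min r (R / 2)) := by
      rw [Metric.mem_ball, dist_eq_norm] at hx ⊢
      rw [add_sub_cancel_left, norm_smul, Real.norm_of_nonneg hs.1]
      nlinarith [hs.2, norm_nonneg (x - p)]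
    have e : p + t • v + s • (x + t • v - (p + t • v)) = (p + s • (x - p)) + t • v := by
      rw [add_sub_add_right_eq_sub]; abel
    simp only [e]
    obtain ⟨h1, h2⟩ := key _ (Metric.ball_subset_ball (min_le_right _ _) hy) t ⟨ht.le, le_rfl⟩
    have h3 : ψ (p + s • (x - p)) < -(m * t) := hrb (Metric.ball_subset_ball (min_le_left _ _) hy)
    exact (hΩ _ h1).2 (by linarith)
  have hs2 : segment ℝ (x + t • v) x ⊆ Ω := by
    rw [segment_symm, segment_eq_image']
    rintro _ ⟨s, hs, rfl⟩
    have e : x + s • (x + t • v - x) = x + (s * t) • v := by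
      rw [add_sub_cancel_left, smul_smul]
    simp only [e]
    have h0 : 0 ≤ s * t := mul_nonneg hs.1 ht.le
    obtain ⟨h1, h2⟩ := key x hxR (s * t) ⟨h0, by nlinarith [hs.2]⟩
    have h3 := (hΩ x hxU).1 hxΩ
    exact (hΩ _ h1).2 (by nlinarith)
  refine ((PolyReach.of_segment hs1).trans (PolyReach.of_segment hs2)).mono ?_
  have e1 : dist (p + t • v) (x + t • v) < min r (R / 2) := by
    rw [dist_add_right, dist_comm]; exact hx
  have e2 : dist (x + t • v) x = t * ‖v‖ := by
    rw [dist_self_add_left, norm_smul, Real.norm_of_nonneg ht.le]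
  linarith

end Geometry

/-- A bounded `C¹` domain has bounded inner diameter. -/
theorem IsBoundedC1Domain.exists_polyReach_le {d : ℕ} {Ω : Set (Rn d)}
    (hΩ : IsBoundedC1Domain Ω) : ∃ L, ∀ x ∈ Ω, ∀ y ∈ Ω, PolyReach Ω x y L := by
  obtain ⟨q, hq⟩ := hΩ.isConnected.nonempty
  have hcomp : IsCompact (closure Ω) := hΩ.isBounded.isCompact_closure
  have main : ∃ L, ∀ x ∈ closure Ω ∩ Ω, PolyReach Ω q x L := by
    refine hcomp.induction_on (p := fun S => ∃ L, ∀ x ∈ S ∩ Ω, PolyReach Ω q x L)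
      ⟨0, by simp⟩ ?_ ?_ ?_
    · rintro S T hST ⟨L, hL⟩
      exact ⟨L, fun x hx => hL x ⟨hST hx.1, hx.2⟩⟩
    · rintro S T ⟨L, hL⟩ ⟨M, hM⟩
      refine ⟨max L M, ?_⟩
      rintro x ⟨hx | hx, hxΩ⟩
      · exact (hL x ⟨hx, hxΩ⟩).mono (le_max_left _ _)
      · exact (hM x ⟨hx, hxΩ⟩).mono (le_max_right _ _)
    · intro p hp
      obtain ⟨q', L, V, hV, h⟩ : ∃ q' L, ∃ V ∈ 𝓝 p, ∀ x ∈ V ∩ Ω, PolyReach Ω q' x L := by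
        by_cases hpΩ : p ∈ Ω
        · obtain ⟨r, hr, hb⟩ := Metric.isOpen_iff.1 hΩ.isOpen p hpΩ
          refine ⟨p, r, Metric.ball p r, Metric.ball_mem_nhds _ hr, fun x hx => ?_⟩
          refine (PolyReach.of_segment (((convex_ball p r).segment_subset
            (Metric.mem_ball_self hr) hx.1).trans hb)).mono ?_
          rw [dist_comm]
          exact (Metric.mem_ball.1 hx.1).le
        · have hfr : p ∈ frontier Ω := by
            rw [hΩ.isOpen.frontier_eq]; exact ⟨hp, hpΩ⟩
          obtain ⟨U, ψ, hU, hpU, hψ, hd, h⟩ := hΩ.c1_boundary p hfr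
          exact exists_nhds_polyReach_of_c1 hp hU hpU hψ hd h
      refine ⟨V, mem_nhdsWithin_of_mem_nhds hV, ?_⟩
      by_cases hne : (V ∩ Ω).Nonempty
      · obtain ⟨x, hx⟩ := hne
        obtain ⟨M, hM⟩ := exists_polyReach hΩ.isOpen hΩ.isConnected.isPreconnected hq
          (h x hx).left_mem
        exact ⟨M + L, fun y hy => hM.trans (h y hy)⟩
      · exact ⟨0, fun y hy => absurd ⟨y, hy⟩ hne⟩
  obtain ⟨L, hL⟩ := main
  exact ⟨L + L, fun x hx y hy =>
    (hL x ⟨subset_closure hx, hx⟩).symm.trans (hL y ⟨subset_closure hy, hy⟩)⟩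

section Harnack

variable {d : ℕ}

/-- The mass of `φ` in the ball of radius `r` around `z`. -/
def ballMass (φ : Rn d → ℝ) (r : ℝ) (z : Rn d) : ℝ := ∫ y in Metric.ball z r, φ y

/-- A one-sided mean value inequality at scale `r`: up to the factor `exp b`, the value of the
positive function `φ` at a point dominates its averages over the nearby balls inside `Ω`. -/
structure IsSuperMean (Ω : Set (Rn d)) (b r : ℝ) (φ : Rn d → ℝ) : Prop where
  integrableOn : IntegrableOn φ Ω
  pos : ∀ x, 0 < φ x
  mean_le : ∀ x ∈ Ω, ∀ z, Metric.ball z r ⊆ Ω → dist x z < 2 * r →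
    Real.exp (-b) * ballMass φ r z ≤ volume.real (Metric.ball (0 : Rn d) r) * φ x

theorem volume_real_ball (z : Rn d) (r : ℝ) :
    volume.real (Metric.ball z r) = volume.real (Metric.ball (0 : Rn d) r) := by
  simp only [Measure.real, Measure.addHaar_ball_center]

theorem volume_real_ball_pos (z : Rn d) {r : ℝ} (hr : 0 < r) :
    0 < volume.real (Metric.ball z r) :=
  ENNReal.toReal_pos (Metric.measure_ball_pos _ _ hr).ne' measure_ball_lt_top.ne

theorem volume_real_ball_mul (r : ℝ) {ε : ℝ} (hε : 0 < ε) :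
    volume.real (Metric.ball (0 : Rn d) (r * ε))
      = ε ^ d * volume.real (Metric.ball (0 : Rn d) r) := by
  have h := Measure.addHaar_ball_mul_of_pos (volume : Measure (Rn d)) 0 hε r
  rw [finrank_euclideanSpace_fin] at h
  simp only [Measure.real]
  rw [mul_comm r, h, ENNReal.toReal_mul, ENNReal.toReal_ofReal (by positivity)]

theorem IsSuperMean.ballMass_le_of_dist_le {Ω : Set (Rn d)} {b r : ℝ} {φ : Rn d → ℝ}
    (h : IsSuperMean Ω b r φ) (hr : 0 < r) {y z : Rn d} (hy : Metric.ball y r ⊆ Ω)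
    (hz : Metric.ball z r ⊆ Ω) (hd : dist y z ≤ r) :
    Real.exp (-b) * ballMass φ r y ≤ ballMass φ r z := by
  have hV := volume_real_ball_pos z hr
  have h1 : ∀ x ∈ Metric.ball z r,
      Real.exp (-b) * ballMass φ r y / volume.real (Metric.ball z r) ≤ φ x := by
    intro x hx
    rw [div_le_iff₀ hV, volume_real_ball z, mul_comm (φ x)]
    refine h.mean_le x (hz hx) y hy ?_
    have := dist_triangle x z y
    rw [Metric.mem_ball] at hx
    rw [dist_comm] at hd
    linarith
  have h2 := setIntegral_mono_on (μ := volume) (integrableOn_const measure_ball_lt_top.ne)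
    (h.integrableOn.mono_set hz) measurableSet_ball h1
  rw [setIntegral_const, smul_eq_mul, mul_div_cancel₀ _ hV.ne'] at h2
  exact h2

theorem IsSuperMean.ballMass_nonneg {Ω : Set (Rn d)} {b r : ℝ} {φ : Rn d → ℝ}
    (h : IsSuperMean Ω b r φ) (s : ℝ) (z : Rn d) : 0 ≤ ballMass φ s z :=
  integral_nonneg fun x => (h.pos x).le

theorem IsSuperMean.ballMass_le_of_dist_le_mul {Ω : Set (Rn d)} {b r : ℝ} {φ : Rn d → ℝ}
    (h : IsSuperMean Ω b r φ) (hr : 0 < r) {y : Rn d} (n : ℕ) :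
    ∀ z, (∀ w ∈ segment ℝ y z, Metric.ball w r ⊆ Ω) → dist y z ≤ n * r →
      Real.exp (-b * n) * ballMass φ r y ≤ ballMass φ r z := by
  induction n with
  | zero =>
    intro z _ hd
    have : y = z := by simpa using hd
    simp [this]
  | succ n ih =>
    intro z hs hd
    set w := AffineMap.lineMap y z ((n : ℝ) / (n + 1)) with hw
    have hn : (0 : ℝ) < n + 1 := by positivity
    have hwz : w ∈ segment ℝ y z := by
      rw [segment_eq_image_lineMap]
      exact ⟨_, ⟨by positivity, (div_le_one hn).2 (by linarith)⟩, rfl⟩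
    have hd1 : dist y w ≤ n * r := by
      rw [hw, dist_left_lineMap, Real.norm_of_nonneg (by positivity), div_mul_eq_mul_div,
        div_le_iff₀ hn]
      push_cast at hd
      nlinarith [(Nat.cast_nonneg n : (0 : ℝ) ≤ n)]
    have hd2 : dist w z ≤ r := by
      have e : 1 - (n : ℝ) / (n + 1) = 1 / (n + 1) := by field_simp; ring
      rw [hw, dist_lineMap_right, e, Real.norm_of_nonneg (by positivity), div_mul_eq_mul_div,
        div_le_iff₀ hn]
      push_cast at hd
      linarith
    have h1 := ih w (fun v hv => hs v ((convex_segment y z).segment_subset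
      (left_mem_segment ℝ y z) hwz hv)) hd1
    have h2 := h.ballMass_le_of_dist_le hr (hs w hwz) (hs z (right_mem_segment ℝ y z)) hd2
    refine le_trans ?_ h2
    calc Real.exp (-b * (n + 1 : ℕ)) * ballMass φ r y
        = Real.exp (-b) * (Real.exp (-b * n) * ballMass φ r y) := by
          rw [← mul_assoc, ← Real.exp_add]; push_cast; ring_nf
      _ ≤ _ := by gcongr

theorem IsSuperMean.ballMass_le_of_segment {Ω : Set (Rn d)} {b r : ℝ} {φ : Rn d → ℝ}
    (h : IsSuperMean Ω b r φ) (hb : 0 ≤ b) (hr : 0 < r) {y z : Rn d}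
    (hs : ∀ w ∈ segment ℝ y z, Metric.ball w r ⊆ Ω) :
    Real.exp (-b * (dist y z / r + 1)) * ballMass φ r y ≤ ballMass φ r z := by
  have h1 := h.ballMass_le_of_dist_le_mul hr ⌈dist y z / r⌉₊ z hs
    ((div_le_iff₀ hr).1 (Nat.le_ceil _))
  refine le_trans ?_ h1
  have h2 : (⌈dist y z / r⌉₊ : ℝ) < dist y z / r + 1 := Nat.ceil_lt_add_one (by positivity)
  refine mul_le_mul_of_nonneg_right (Real.exp_le_exp.2 ?_) (h.ballMass_nonneg _ _)
  nlinarith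

theorem tendsto_const_mul_zero {l : Filter ℝ} (hl : l ≤ 𝓝[>] (0 : ℝ)) (C : ℝ) :
    Tendsto (fun ε : ℝ => C * ε) l (𝓝 0) := by
  have : Tendsto (fun ε : ℝ => C * ε) (𝓝 0) (𝓝 (C * 0)) := (continuous_const_mul C).tendsto 0
  rw [mul_zero] at this
  exact this.mono_left (hl.trans nhdsWithin_le_nhds)

theorem eventually_ball_subset_of_isCompact {Ω K : Set (Rn d)} (ho : IsOpen Ω) (hK : IsCompact K)
    (hs : K ⊆ Ω) {l : Filter ℝ} (hl : l ≤ 𝓝[>] (0 : ℝ)) (ρ : ℝ) :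
    ∀ᶠ ε in l, ∀ w ∈ K, Metric.ball w (ρ * ε) ⊆ Ω := by
  obtain ⟨δ, hδ, hsub⟩ := hK.exists_thickening_subset_open ho hs
  filter_upwards [(tendsto_const_mul_zero hl ρ).eventually (gt_mem_nhds hδ)] with ε hε w hw x hx
  exact hsub (Metric.mem_thickening_iff.2 ⟨w, hw, (Metric.mem_ball.1 hx).trans hε⟩)

theorem isCompact_segment (y z : Rn d) : IsCompact (segment ℝ y z) := by
  rw [segment_eq_image_lineMap]
  exact isCompact_Icc.image AffineMap.lineMap_continuous

variable {Ω : Set (Rn d)} {b ρ : ℝ} {l : Filter ℝ} {φ : ℝ → Rn d → ℝ}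

theorem PolyReach.eventually_ballMass_le (ho : IsOpen Ω) (hb : 0 ≤ b) (hρ : 0 < ρ)
    (hl : l ≤ 𝓝[>] (0 : ℝ)) (h : ∀ᶠ ε in l, IsSuperMean Ω b (ρ * ε) (φ ε))
    {x y : Rn d} {L : ℝ} (hxy : PolyReach Ω x y L) :
    ∃ N : ℝ, ∀ᶠ ε in l, Real.exp (-b * (L / (ρ * ε) + N)) * ballMass (φ ε) (ρ * ε) x
      ≤ ballMass (φ ε) (ρ * ε) y := by
  have hpos : ∀ᶠ ε in l, (0 : ℝ) < ε := hl self_mem_nhdsWithin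
  induction hxy with
  | @refl L hx hL =>
    refine ⟨0, ?_⟩
    filter_upwards [h, hpos] with ε hε h0
    have : Real.exp (-b * (L / (ρ * ε) + 0)) ≤ 1 := by
      rw [Real.exp_le_one_iff]
      have : 0 ≤ L / (ρ * ε) := by positivity
      nlinarith
    nlinarith [hε.ballMass_nonneg (ρ * ε) x]
  | @step y z L L' _ hs hL ih =>
    obtain ⟨N, hN⟩ := ih
    refine ⟨N + 1, ?_⟩
    filter_upwards [h, hpos, hN,
      eventually_ball_subset_of_isCompact ho (isCompact_segment y z) hs hl ρ]
      with ε hε h0 h1 h2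
    have h3 := hε.ballMass_le_of_segment hb (by positivity) h2
    refine le_trans ?_ h3
    refine le_trans ?_ (mul_le_mul_of_nonneg_left h1 (Real.exp_pos _).le)
    rw [← mul_assoc, ← Real.exp_add]
    refine mul_le_mul_of_nonneg_right (Real.exp_le_exp.2 ?_) (hε.ballMass_nonneg _ _)
    have : (L + dist y z) / (ρ * ε) ≤ L' / (ρ * ε) := by gcongr
    rw [add_div] at this
    nlinarith

/-- A Harnack inequality between ball masses whose constant does not depend on the compact set. -/
theorem exists_eventually_ballMass_le (ho : IsOpen Ω)
    (hL : ∃ L, ∀ x ∈ Ω, ∀ y ∈ Ω, PolyReach Ω x y L) (hb : 0 ≤ b) (hρ : 0 < ρ)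
    (hl : l ≤ 𝓝[>] (0 : ℝ)) (h : ∀ᶠ ε in l, IsSuperMean Ω b (ρ * ε) (φ ε)) :
    ∃ C : ℝ, ∀ K : Set (Rn d × Rn d), IsCompact K → K ⊆ Ω ×ˢ Ω → ∀ᶠ ε in l, ∀ q ∈ K,
      Real.exp (-(C / ε)) * ballMass (φ ε) (ρ * ε) q.1 ≤ ballMass (φ ε) (ρ * ε) q.2 := by
  obtain ⟨L, hL⟩ := hL
  have hpos : ∀ᶠ ε in l, (0 : ℝ) < ε := hl self_mem_nhdsWithin
  refine ⟨b * ((L + 2) / ρ) + 1, fun K hK hKΩ => ?_⟩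
  refine hK.induction_on (p := fun S => ∀ᶠ ε in l, ∀ q ∈ S,
      Real.exp (-((b * ((L + 2) / ρ) + 1) / ε)) * ballMass (φ ε) (ρ * ε) q.1
        ≤ ballMass (φ ε) (ρ * ε) q.2) (by simp) ?_ ?_ ?_
  · intro S T hST hT
    filter_upwards [hT] with ε hε q hq using hε q (hST hq)
  · intro S T hS hT
    filter_upwards [hS, hT] with ε h1 h2 q hq
    exact hq.elim (h1 q) (h2 q)
  rintro ⟨x, y⟩ hxy
  obtain ⟨hx, hy⟩ : x ∈ Ω ∧ y ∈ Ω := hKΩ hxy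
  have hloc : ∀ x ∈ Ω, ∃ r > 0, r ≤ 1 ∧ Metric.ball x (2 * r) ⊆ Ω := by
    intro x hx
    obtain ⟨r, hr, hb⟩ := Metric.isOpen_iff.1 ho x hx
    refine ⟨min (r / 2) 1, by positivity, min_le_right _ _, ?_⟩
    refine (Metric.ball_subset_ball ?_).trans hb
    have := min_le_left (r / 2) 1
    linarith
  have hseg : ∀ {x : Rn d} {r : ℝ}, 0 < r → Metric.ball x (2 * r) ⊆ Ω → ∀ u ∈ Metric.ball x r,
      ∀ s ≤ r, ∀ w ∈ segment ℝ u x, Metric.ball w s ⊆ Ω := by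
    intro x r hr hb u hu s hs w hw v hv
    have hw' := (convex_ball x r).segment_subset hu (Metric.mem_ball_self hr) hw
    apply hb
    rw [Metric.mem_ball] at hw' hv ⊢
    have := dist_triangle v w x
    linarith
  obtain ⟨r, hr, hr1, hrb⟩ := hloc x hx
  obtain ⟨s, hs, hs1, hsb⟩ := hloc y hy
  refine ⟨Metric.ball x r ×ˢ Metric.ball y s, mem_nhdsWithin_of_mem_nhds
    (prod_mem_nhds (Metric.ball_mem_nhds _ hr) (Metric.ball_mem_nhds _ hs)), ?_⟩
  obtain ⟨N, hN⟩ := (hL x hx y hy).eventually_ballMass_le ho hb hρ hl h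
  have ht : ∀ C t : ℝ, 0 < t → ∀ᶠ ε in l, C * ε < t :=
    fun C t ht => (tendsto_const_mul_zero hl C).eventually (gt_mem_nhds ht)
  filter_upwards [h, hpos, hN, ht ρ r hr, ht ρ s hs, ht (b * (N + 2)) 1 one_pos]
    with ε hε h0 h1 h2 h3 h4
  rintro ⟨u, v⟩ ⟨hu, hv⟩
  have hρε : 0 < ρ * ε := by positivity
  have k1 := hε.ballMass_le_of_segment hb hρε (hseg hr hrb u hu _ h2.le)
  have k2 := hε.ballMass_le_of_segment hb hρε (y := y) (z := v)
    (by rw [segment_symm]; exact hseg hs hsb v hv _ h3.le)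
  have k3 := mul_le_mul_of_nonneg_left (h1.trans' (mul_le_mul_of_nonneg_left k1
    (Real.exp_pos _).le)) (Real.exp_pos (-b * (dist y v / (ρ * ε) + 1))).le
  refine le_trans ?_ (k3.trans k2)
  rw [← mul_assoc, ← mul_assoc, ← Real.exp_add, ← Real.exp_add]
  refine mul_le_mul_of_nonneg_right (Real.exp_le_exp.2 ?_) (hε.ballMass_nonneg _ _)
  have d1 : dist u x ≤ 1 := (Metric.mem_ball.1 hu).le.trans hr1
  have d2 : dist y v ≤ 1 := by rw [dist_comm]; exact (Metric.mem_ball.1 hv).le.trans hs1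
  have e : (b * ((L + 2) / ρ) + 1) / ε = b * ((L + 2) / (ρ * ε)) + 1 / ε := by
    field_simp
  have h5 : b * (N + 2) ≤ 1 / ε := by rw [le_div_iff₀ h0]; exact h4.le
  have h6 : dist y v / (ρ * ε) + (L / (ρ * ε) + dist u x / (ρ * ε)) ≤ (L + 2) / (ρ * ε) := by
    rw [← add_div, ← add_div]
    exact div_le_div_of_nonneg_right (by linarith) hρε.le
  have h7 := mul_le_mul_of_nonneg_left h6 hb
  rw [e]
  linarith

end Harnack

section Coefficients

variable {d : ℕ} {Ω : Set (Rn d)}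

/-- The closed unit cube, a compact set of representatives of the torus. -/
def unitCube (d : ℕ) : Set (Rn d) := {ξ | ∀ i, ξ i ∈ Icc (0 : ℝ) 1}

theorem isCompact_unitCube (d : ℕ) : IsCompact (unitCube d) := by
  have h : IsCompact (Set.pi univ fun _ : Fin d => Icc (0 : ℝ) 1) :=
    isCompact_univ_pi fun _ => isCompact_Icc
  convert h.image (PiLp.continuous_toLp 2 fun _ : Fin d => ℝ) using 1
  ext ξ
  constructor
  · intro hξ
    exact ⟨fun i => ξ i, fun i _ => hξ i, rfl⟩
  · rintro ⟨f, hf, rfl⟩ i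
    exact hf i (mem_univ i)

theorem unitCube_nonempty (d : ℕ) : (unitCube d).Nonempty := ⟨0, fun i => by simp⟩

theorem exists_add_latticeVec_mem_unitCube (ξ : Rn d) :
    ∃ k : Fin d → ℤ, ξ + latticeVec k ∈ unitCube d := by
  refine ⟨fun i => -⌊ξ i⌋, fun i => ?_⟩
  have h1 := Int.floor_le (ξ i)
  have h2 := Int.lt_floor_add_one (ξ i)
  simp only [latticeVec, PiLp.add_apply, Int.cast_neg]
  constructor <;> linarith

theorem IsAdmissibleKappa.exists_bounds {κ : Rn d → Rn d → Rn d → Rn d → ℝ}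
    (hκ : IsAdmissibleKappa Ω κ) (hΩ : IsCompact (closure Ω)) (hne : Ω.Nonempty) :
    ∃ k₀ k₁ : ℝ, 0 < k₀ ∧ ∀ x ∈ closure Ω, ∀ y ∈ closure Ω, ∀ ξ η,
      k₀ ≤ κ x y ξ η ∧ κ x y ξ η ≤ k₁ := by
  set Q := closure Ω ×ˢ (closure Ω ×ˢ (unitCube d ×ˢ unitCube d)) with hQ
  have hQc : IsCompact Q :=
    hΩ.prod (hΩ.prod ((isCompact_unitCube d).prod (isCompact_unitCube d)))
  have hQn : Q.Nonempty := (hne.mono subset_closure).prod ((hne.mono subset_closure).prod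
    ((unitCube_nonempty d).prod (unitCube_nonempty d)))
  have hc := hκ.continuousOn.mono (t := Q)
    (prod_mono le_rfl (prod_mono le_rfl (prod_mono (subset_univ _) (subset_univ _))))
  obtain ⟨p, hp, hmin⟩ := hQc.exists_isMinOn hQn hc
  obtain ⟨q, hq, hmax⟩ := hQc.exists_isMaxOn hQn hc
  refine ⟨_, κ q.1 q.2.1 q.2.2.1 q.2.2.2, hκ.pos p.1 hp.1 p.2.1 hp.2.1 p.2.2.1 p.2.2.2,
    fun x hx y hy ξ η => ?_⟩
  obtain ⟨k, hk⟩ := exists_add_latticeVec_mem_unitCube ξ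
  obtain ⟨j, hj⟩ := exists_add_latticeVec_mem_unitCube η
  have e : κ x y ξ η = κ x y (ξ + latticeVec k) (η + latticeVec j) :=
    ((hκ.periodic_left x hx y hy (η + latticeVec j) k ξ).trans
      (hκ.periodic_right x hx y hy ξ j η)).symm
  have hm : (x, y, ξ + latticeVec k, η + latticeVec j) ∈ Q := ⟨hx, hy, hk, hj⟩
  rw [e]
  exact ⟨hmin hm, hmax hm⟩

theorem IsAdmissiblePotential.exists_bounds {a : Rn d → Rn d → ℝ}
    (ha : IsAdmissiblePotential Ω a) (hΩ : IsCompact (closure Ω)) :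
    ∃ A : ℝ, ∀ x ∈ closure Ω, ∀ ξ, |a x ξ| ≤ A := by
  have hc := ha.continuousOn.mono (t := closure Ω ×ˢ unitCube d) (prod_mono le_rfl (subset_univ _))
  obtain ⟨A, hA⟩ := (hΩ.prod (isCompact_unitCube d)).exists_bound_of_continuousOn hc
  refine ⟨A, fun x hx ξ => ?_⟩
  obtain ⟨k, hk⟩ := exists_add_latticeVec_mem_unitCube ξ
  rw [← ha.periodic x hx k ξ]
  exact hA (x, ξ + latticeVec k) ⟨hx, hk⟩

theorem IsDispersalKernel.integrable {J : Rn d → ℝ} (hJ : IsDispersalKernel J) : Integrable J := by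
  obtain ⟨C, β, hC, hβ, hdec⟩ := hJ.decay
  have hint : Integrable (fun z : Rn d => (1 + ‖z‖) ^ (-((d + 1 : ℕ) : ℝ))) :=
    integrable_one_add_norm (by rw [finrank_euclideanSpace_fin]; push_cast; linarith)
  refine (hint.const_mul (C * (Real.exp 2 * (d + 1).factorial))).mono'
    hJ.continuous.aestronglyMeasurable (ae_of_all _ fun z => ?_)
  rw [Real.norm_of_nonneg (hJ.nonneg z)]
  refine (hdec z).trans ?_
  rw [mul_assoc]
  refine mul_le_mul_of_nonneg_left ?_ hC.le
  have h1 : ‖z‖ ≤ ‖z‖ ^ (1 + β) + 1 := by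
    rcases le_total ‖z‖ 1 with h | h
    · have := Real.rpow_nonneg (norm_nonneg z) (1 + β)
      linarith
    · have := Real.rpow_le_rpow_of_exponent_le h (by linarith : (1 : ℝ) ≤ 1 + β)
      rw [Real.rpow_one] at this
      linarith
  have hz : 0 < 1 + ‖z‖ := by positivity
  have h2 := Real.pow_div_factorial_le_exp (1 + ‖z‖) hz.le (d + 1)
  have hf : (0 : ℝ) < (d + 1).factorial := by positivity
  rw [div_le_iff₀ hf] at h2
  rw [Real.rpow_neg hz.le, Real.rpow_natCast, ← div_eq_mul_inv, le_div_iff₀ (by positivity)]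
  calc Real.exp (-‖z‖ ^ (1 + β)) * (1 + ‖z‖) ^ (d + 1)
      ≤ Real.exp (-‖z‖ ^ (1 + β)) * (Real.exp (1 + ‖z‖) * (d + 1).factorial) := by gcongr
    _ = Real.exp (-‖z‖ ^ (1 + β) + (1 + ‖z‖)) * (d + 1).factorial := by
        rw [← mul_assoc, ← Real.exp_add]
    _ ≤ Real.exp 2 * (d + 1).factorial := by
        gcongr
        linarith

theorem IsDispersalKernel.integrable_scaled {J : Rn d → ℝ} (hJ : IsDispersalKernel J) {ε : ℝ}
    (hε : 0 < ε) (x : Rn d) : Integrable fun y => J (ε⁻¹ • (x - y)) := by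
  have h := (integrable_comp_smul_iff volume J (inv_ne_zero hε.ne')).2 hJ.integrable
  exact h.comp_sub_left x

theorem integral_scaled (J : Rn d → ℝ) {ε : ℝ} (hε : 0 < ε) (x : Rn d) :
    ∫ y, J (ε⁻¹ • (x - y)) = ε ^ d * ∫ z, J z := by
  rw [integral_sub_left_eq_self (fun z => J (ε⁻¹ • z)), Measure.integral_comp_inv_smul,
    finrank_euclideanSpace_fin, abs_of_pos (by positivity), smul_eq_mul]

theorem IsAdmissibleKappa.integrableOn {κ : Rn d → Rn d → Rn d → Rn d → ℝ}
    (hκ : IsAdmissibleKappa Ω κ) (hΩ : IsCompact (closure Ω)) {J : Rn d → ℝ} (hJ : Continuous J)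
    {v : Rn d → ℝ} (hv : ContinuousOn v (closure Ω)) (ε : ℝ) {x : Rn d} (hx : x ∈ closure Ω) :
    IntegrableOn (fun y => J (ε⁻¹ • (x - y)) * κ x y (ε⁻¹ • x) (ε⁻¹ • y) * v y) Ω := by
  have h1 : ContinuousOn (fun y => κ x y (ε⁻¹ • x) (ε⁻¹ • y)) (closure Ω) :=
    hκ.continuousOn.comp (f := fun y => (x, y, ε⁻¹ • x, ε⁻¹ • y)) (by fun_prop)
      fun y hy => ⟨hx, hy, mem_univ _, mem_univ _⟩
  have h2 : ContinuousOn (fun y => J (ε⁻¹ • (x - y))) (closure Ω) := by fun_prop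
  exact (((h2.mul h1).mul hv).integrableOn_compact hΩ).mono_set subset_closure

/-- A lower bound of `λ_ε` that does not depend on `ε`. -/
theorem exists_le_bottomPoint {J : Rn d → ℝ} (hJ : IsDispersalKernel J)
    {κ : Rn d → Rn d → Rn d → Rn d → ℝ} (hκ : IsAdmissibleKappa Ω κ) {a : Rn d → Rn d → ℝ}
    (ha : IsAdmissiblePotential Ω a) (hΩ : IsCompact (closure Ω)) (ho : IsOpen Ω)
    (hne : Ω.Nonempty) :
    ∃ Λ : ℝ, ∀ ε : ℝ, 0 < ε → Λ ≤ bottomPoint Ω J κ a ε := by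
  obtain ⟨k₀, k₁, hk₀, hk⟩ := hκ.exists_bounds hΩ hne
  obtain ⟨A, hA⟩ := ha.exists_bounds hΩ
  refine ⟨-(k₁ * ∫ z, J z) - A, fun ε hε => le_csSup ?_ ?_⟩
  · refine ⟨A, ?_⟩
    rintro lam ⟨v, -, hv, hle⟩
    obtain ⟨x, hx⟩ := hne
    have hx' := subset_closure hx
    have h1 := hle x hx
    have h2 : 0 ≤ ∫ y in Ω, J (ε⁻¹ • (x - y)) * κ x y (ε⁻¹ • x) (ε⁻¹ • y) * v y :=
      setIntegral_nonneg ho.measurableSet fun y hy => mul_nonneg (mul_nonneg (hJ.nonneg _)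
        (hκ.pos x hx' y (subset_closure hy) _ _).le) (hv y (subset_closure hy)).le
    have h3 : 0 ≤ (1 / ε ^ d) *
        ∫ y in Ω, J (ε⁻¹ • (x - y)) * κ x y (ε⁻¹ • x) (ε⁻¹ • y) * v y := by positivity
    have h4 := (abs_le.1 (hA x hx' (ε⁻¹ • x))).2
    unfold nonlocalOp at h1
    have h5 : a x (ε⁻¹ • x) * v x ≤ A * v x := mul_le_mul_of_nonneg_right h4 (hv x hx').le
    exact le_of_mul_le_mul_right (by linarith) (hv x hx')
  · refine ⟨fun _ => 1, continuousOn_const, fun _ _ => one_pos, fun x hx => ?_⟩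
    have hx' := subset_closure hx
    have h4 := (abs_le.1 (hA x hx' (ε⁻¹ • x))).1
    have hk1 : 0 ≤ k₁ := hk₀.le.trans ((hk x hx' x hx' x x).1.trans (hk x hx' x hx' x x).2)
    have h1 : ∫ y in Ω, J (ε⁻¹ • (x - y)) * κ x y (ε⁻¹ • x) (ε⁻¹ • y) * 1
        ≤ k₁ * (ε ^ d * ∫ z, J z) := by
      rw [← integral_scaled J hε x, ← integral_const_mul]
      calc _ ≤ ∫ y in Ω, k₁ * J (ε⁻¹ • (x - y)) := by
            refine setIntegral_mono_on (hκ.integrableOn hΩ hJ.continuous continuousOn_const ε hx')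
              ((hJ.integrable_scaled hε x).const_mul k₁).integrableOn ho.measurableSet
              fun y hy => ?_
            rw [mul_one, mul_comm]
            exact mul_le_mul_of_nonneg_right (hk x hx' y (subset_closure hy) _ _).2 (hJ.nonneg _)
        _ ≤ _ := setIntegral_le_integral ((hJ.integrable_scaled hε x).const_mul k₁)
            (ae_of_all _ fun y => mul_nonneg hk1 (hJ.nonneg _))
    have h2 : (1 / ε ^ d) * ∫ y in Ω, J (ε⁻¹ • (x - y)) * κ x y (ε⁻¹ • x) (ε⁻¹ • y) * 1
        ≤ k₁ * ∫ z, J z := by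
      rw [one_div, inv_mul_le_iff₀ (by positivity)]
      linarith
    unfold nonlocalOp
    linarith

theorem exists_exp_neg_le {t : ℝ} (ht : 0 < t) : ∃ b : ℝ, 0 ≤ b ∧ Real.exp (-b) ≤ t := by
  refine ⟨max 0 (-Real.log t), le_max_left _ _, ?_⟩
  rw [← Real.le_log_iff_exp_le ht]
  linarith [le_max_right 0 (-Real.log t)]

/-- The eigenfunctions satisfy a one-sided mean value inequality, uniformly in `ε`. -/
theorem exists_isSuperMean (hΩ : IsBoundedC1Domain Ω) {J : Rn d → ℝ} (hJ : IsDispersalKernel J)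
    {κ : Rn d → Rn d → Rn d → Rn d → ℝ} (hκ : IsAdmissibleKappa Ω κ) {a : Rn d → Rn d → ℝ}
    (ha : IsAdmissiblePotential Ω a) :
    ∃ b ρ : ℝ, 0 ≤ b ∧ 0 < ρ ∧ ∀ ε : ℝ, 0 < ε → ∀ W : Rn d → ℝ,
      IsLogEigenfunction Ω J κ a ε W →
        IsSuperMean Ω b (ρ * ε) (fun y => Real.exp (-(W y / ε))) := by
  have hc : IsCompact (closure Ω) := hΩ.isBounded.isCompact_closure
  have hne := hΩ.isConnected.nonempty
  obtain ⟨k₀, k₁, hk₀, hk⟩ := hκ.exists_bounds hc hne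
  obtain ⟨A, hA⟩ := ha.exists_bounds hc
  obtain ⟨Λ, hΛ⟩ := exists_le_bottomPoint hJ hκ ha hc hΩ.isOpen hne
  obtain ⟨δ, hδ, hJδ⟩ := Metric.mem_nhds_iff.1 (hJ.continuous.continuousAt.eventually
    (lt_mem_nhds (half_lt_self hJ.pos_zero)))
  set ρ := δ / 3 with hρ
  have hρ0 : 0 < ρ := by positivity
  set M := max (A - Λ) 1 with hM
  have hM0 : 0 < M := by positivity
  have hj0 : 0 < J 0 / 2 := half_pos hJ.pos_zero
  have hV := volume_real_ball_pos (0 : Rn d) hρ0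
  obtain ⟨b, hb, hbt⟩ := exists_exp_neg_le
    (show 0 < J 0 / 2 * k₀ * volume.real (Metric.ball (0 : Rn d) ρ) / M by positivity)
  refine ⟨b, ρ, hb, hρ0, fun ε hε W hW => ?_⟩
  have hcont : ContinuousOn (fun y => Real.exp (-(W y / ε))) (closure Ω) :=
    (hW.continuousOn.div_const ε).neg.rexp
  have hint := (hcont.integrableOn_compact (μ := volume) hc).mono_set subset_closure
  refine ⟨hint, fun x => Real.exp_pos _, fun x hx z hz hxz => ?_⟩
  have hx' := subset_closure hx
  set φ := fun y => Real.exp (-(W y / ε)) with hφ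
  have hJκ := hκ.integrableOn hc hJ.continuous hcont ε hx'
  have h1 : J 0 / 2 * k₀ * ballMass φ (ρ * ε) z
      ≤ ∫ y in Ω, J (ε⁻¹ • (x - y)) * κ x y (ε⁻¹ • x) (ε⁻¹ • y) * φ y := by
    calc _ = ∫ y in Metric.ball z (ρ * ε), J 0 / 2 * k₀ * φ y := by
          rw [integral_const_mul]; rfl
      _ ≤ ∫ y in Metric.ball z (ρ * ε),
          J (ε⁻¹ • (x - y)) * κ x y (ε⁻¹ • x) (ε⁻¹ • y) * φ y := by
          refine setIntegral_mono_on ((hint.mono_set hz).const_mul _) (hJκ.mono_set hz)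
            measurableSet_ball fun y hy => ?_
          refine mul_le_mul_of_nonneg_right ?_ (Real.exp_pos _).le
          refine mul_le_mul (le_of_lt ?_) (hk x hx' y (subset_closure (hz hy)) _ _).1 hk₀.le
            (hJ.nonneg _)
          refine hJδ (mem_ball_zero_iff.2 ?_)
          rw [norm_smul, Real.norm_of_nonneg (by positivity), inv_mul_lt_iff₀ hε, ← dist_eq_norm]
          have := dist_triangle_right x y z
          rw [Metric.mem_ball] at hy
          have e : ε * δ = 3 * (ρ * ε) := by rw [hρ]; ring
          linarith
      _ ≤ _ := by
          refine setIntegral_mono_set hJκ ?_ hz.eventuallyLE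
          refine (ae_restrict_iff' hΩ.isOpen.measurableSet).2 (ae_of_all _ fun y hy => ?_)
          exact mul_nonneg (mul_nonneg (hJ.nonneg _)
            (hκ.pos x hx' y (subset_closure hy) _ _).le) (Real.exp_pos _).le
  have h2 : ∫ y in Ω, J (ε⁻¹ • (x - y)) * κ x y (ε⁻¹ • x) (ε⁻¹ • y) * φ y
      ≤ ε ^ d * (M * φ x) := by
    have he := hW.eigen x hx
    unfold nonlocalOp at he
    have h3 : (1 / ε ^ d) * (∫ y in Ω, J (ε⁻¹ • (x - y)) * κ x y (ε⁻¹ • x) (ε⁻¹ • y) * φ y)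
        = (a x (ε⁻¹ • x) - bottomPoint Ω J κ a ε) * φ x := by linarith
    have h4 : a x (ε⁻¹ • x) - bottomPoint Ω J κ a ε ≤ M :=
      le_trans (by linarith [hΛ ε hε, (abs_le.1 (hA x hx' (ε⁻¹ • x))).2]) (le_max_left _ _)
    rw [← inv_mul_le_iff₀ (by positivity), ← one_div, h3]
    exact mul_le_mul_of_nonneg_right h4 (Real.exp_pos _).le
  have hB : 0 ≤ ballMass φ (ρ * ε) z := integral_nonneg fun y => (Real.exp_pos _).le
  rw [volume_real_ball_mul ρ hε]
  calc Real.exp (-b) * ballMass φ (ρ * ε) z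
      ≤ J 0 / 2 * k₀ * volume.real (Metric.ball (0 : Rn d) ρ) / M * ballMass φ (ρ * ε) z := by
        gcongr
    _ = volume.real (Metric.ball (0 : Rn d) ρ) / M * (J 0 / 2 * k₀ * ballMass φ (ρ * ε) z) := by
        ring
    _ ≤ volume.real (Metric.ball (0 : Rn d) ρ) / M * (ε ^ d * (M * φ x)) :=
        mul_le_mul_of_nonneg_left (h1.trans h2) (by positivity)
    _ = ε ^ d * volume.real (Metric.ball (0 : Rn d) ρ) * φ x := by
        field_simp

end Coefficients

section RelaxedLimit

variable {d : ℕ}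

/-- Some ball of radius `r` centred near `T` carries its share of the mass of `φ` on `T`. -/
theorem exists_le_ballMass {Ω T : Set (Rn d)} {φ : Rn d → ℝ} (hT : IsOpen T) (hne : T.Nonempty)
    (hTb : Bornology.IsBounded T) (hφ : IntegrableOn φ Ω) (hpos : ∀ x, 0 < φ x) {δ r : ℝ}
    (hr : 0 < r) (hrδ : r ≤ δ) (hδ : Metric.thickening (2 * δ) T ⊆ Ω) :
    ∃ z ∈ Metric.thickening δ T, volume.real (Metric.ball (0 : Rn d) r) * ∫ x in T, φ x
      ≤ volume.real (Metric.thickening δ T) * ballMass φ r z := by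
  have hδ0 : 0 < δ := hr.trans_le hrδ
  set S := Metric.thickening δ T with hS
  have hSo : IsOpen S := Metric.isOpen_thickening
  have hTS : T ⊆ S := Metric.self_subset_thickening hδ0 T
  have hTΩ : T ⊆ Ω := (Metric.self_subset_thickening (by positivity) T).trans hδ
  have hS0 : volume S ≠ 0 := (hSo.measure_pos _ (hne.mono hTS)).ne'
  have hStop : volume S ≠ ⊤ := (hTb.thickening (δ := δ)).measure_lt_top.ne
  set ν := (volume.restrict T).withDensity (fun y => ENNReal.ofReal (φ y)) with hν
  have hint := hφ.mono_set hTΩ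
  have : IsFiniteMeasure ν := isFiniteMeasure_withDensity_ofReal hint.hasFiniteIntegral
  have hνuniv : ν univ = ENNReal.ofReal (∫ x in T, φ x) := by
    rw [hν, withDensity_apply _ MeasurableSet.univ, Measure.restrict_univ,
      ofReal_integral_eq_lintegral_ofReal hint (ae_of_all _ fun x => (hpos x).le)]
  have hsub : ∀ z ∈ S, Metric.ball z r ⊆ Ω := by
    intro z hz x hx
    apply hδ
    obtain ⟨y, hy, hzy⟩ := Metric.mem_thickening_iff.1 hz
    refine Metric.mem_thickening_iff.2 ⟨y, hy, ?_⟩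
    have := dist_triangle x z y
    rw [Metric.mem_ball] at hx
    linarith
  have hνball : ∀ z ∈ S, ν (Metric.ball z r) ≤ ENNReal.ofReal (ballMass φ r z) := by
    intro z hz
    rw [hν, withDensity_apply _ measurableSet_ball, Measure.restrict_restrict measurableSet_ball,
      ballMass, ofReal_integral_eq_lintegral_ofReal (hφ.mono_set (hsub z hz))
        (ae_of_all _ fun x => (hpos x).le)]
    exact lintegral_mono_set inter_subset_left
  have hE : MeasurableSet {q : Rn d × Rn d | dist q.2 q.1 < r} :=
    (isOpen_lt (by fun_prop) continuous_const).measurableSet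
  have hfub : ∫⁻ z in S, ν (Metric.ball z r) = volume (Metric.ball (0 : Rn d) r) * ν univ := by
    have h1 := Measure.prod_apply (μ := volume.restrict S) (ν := ν) hE
    have h2 := Measure.prod_apply_symm (μ := volume.restrict S) (ν := ν) hE
    calc ∫⁻ z in S, ν (Metric.ball z r)
        = ∫⁻ y, volume.restrict S (Metric.ball y r) ∂ν := by
          rw [h1] at h2
          have e : ∀ y : Rn d,
              (fun x => (x, y)) ⁻¹' {q : Rn d × Rn d | dist q.2 q.1 < r} = Metric.ball y r := by
            intro y
            ext x
            simp [dist_comm]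
          simp only [e] at h2
          exact h2
      _ = ∫⁻ y, volume (Metric.ball (0 : Rn d) r) ∂ν := by
          refine lintegral_congr_ae ?_
          refine (withDensity_absolutelyContinuous _ _).ae_le ?_
          refine (ae_restrict_iff' hT.measurableSet).2 (ae_of_all _ fun y hy => ?_)
          simp only
          rw [Measure.restrict_apply measurableSet_ball, inter_eq_left.2,
            Measure.addHaar_ball_center]
          exact (Metric.ball_subset_ball hrδ).trans (Metric.ball_subset_thickening hy δ)
      _ = _ := lintegral_const _
  have hfin : ∫⁻ z in S, ν (Metric.ball z r) ≠ ⊤ := by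
    rw [hfub]
    exact ENNReal.mul_ne_top measure_ball_lt_top.ne (measure_ne_top _ _)
  obtain ⟨z, hz, hle⟩ := exists_setLAverage_le hS0 hSo.measurableSet.nullMeasurableSet hfin
  refine ⟨z, hz, ?_⟩
  rw [setLAverage_eq, hfub, ENNReal.div_le_iff hS0 hStop, hνuniv] at hle
  have h3 := hle.trans (mul_le_mul_left (hνball z hz) _)
  have h4 := ENNReal.toReal_mono (ENNReal.mul_ne_top ENNReal.ofReal_ne_top hStop) h3
  rw [ENNReal.toReal_mul, ENNReal.toReal_mul,
    ENNReal.toReal_ofReal (integral_nonneg fun x => (hpos x).le),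
    ENNReal.toReal_ofReal (show 0 ≤ ballMass φ r z from integral_nonneg fun x => (hpos x).le),
    mul_comm (ballMass φ r z)] at h4
  exact h4

/-- If the mass of `exp (-W / ε)` in some ball of radius `ρ ε` is at least of order
`ε ^ d * exp (m / ε)`, then `W ≤ C - m + 1` on compact sets. -/
theorem exists_eventually_le_of_le_ballMass {Ω : Set (Rn d)} {b ρ : ℝ} {l : Filter ℝ}
    {W : ℝ → Rn d → ℝ} (ho : IsOpen Ω) (hL : ∃ L, ∀ x ∈ Ω, ∀ y ∈ Ω, PolyReach Ω x y L)
    (hb : 0 ≤ b) (hρ : 0 < ρ) (hl : l ≤ 𝓝[>] (0 : ℝ))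
    (h : ∀ᶠ ε in l, IsSuperMean Ω b (ρ * ε) (fun y => Real.exp (-(W ε y / ε)))) :
    ∃ C : ℝ, ∀ K : Set (Rn d × Rn d), IsCompact K → K ⊆ Ω ×ˢ Ω → ∀ c m : ℝ, 0 < c →
      ∀ᶠ ε in l, ∀ q ∈ K, c * ε ^ d * Real.exp (m / ε)
        ≤ ballMass (fun y => Real.exp (-(W ε y / ε))) (ρ * ε) q.1 → W ε q.2 ≤ C - m + 1 := by
  obtain ⟨C, hC⟩ := exists_eventually_ballMass_le ho hL hb hρ hl h
  refine ⟨C, fun K hK hKΩ c m hc => ?_⟩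
  have hpos : ∀ᶠ ε in l, (0 : ℝ) < ε := hl self_mem_nhdsWithin
  have hV := volume_real_ball_pos (0 : Rn d) hρ
  set V := volume.real (Metric.ball (0 : Rn d) ρ) with hVdef
  set s := Real.log (Real.exp (-b) * c / V) with hs
  have hball := eventually_ball_subset_of_isCompact ho (hK.image continuous_snd)
    (by rintro _ ⟨q, hq, rfl⟩; exact (hKΩ hq).2) hl ρ
  filter_upwards [hC K hK hKΩ, h, hpos, hball,
    (tendsto_const_mul_zero hl (-s)).eventually (gt_mem_nhds one_pos)] with ε h1 h2 h0 h3 h4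
  intro q hq hm
  have hρε : 0 < ρ * ε := by positivity
  have h5 := h2.mean_le q.2 (hKΩ hq).2 q.2 (h3 _ ⟨q, hq, rfl⟩) (by rw [dist_self]; positivity)
  rw [volume_real_ball_mul ρ h0, ← hVdef] at h5
  have h6 : Real.exp (-b) * (Real.exp (-(C / ε)) * (c * ε ^ d * Real.exp (m / ε)))
      ≤ ε ^ d * V * Real.exp (-(W ε q.2 / ε)) := by
    refine le_trans ?_ h5
    refine mul_le_mul_of_nonneg_left ((mul_le_mul_of_nonneg_left hm ?_).trans (h1 q hq)) ?_ <;>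
      positivity
  have h7 : Real.exp (s + (-(C / ε) + m / ε)) ≤ Real.exp (-(W ε q.2 / ε)) := by
    rw [Real.exp_add, hs, Real.exp_log (by positivity), Real.exp_add, div_mul_eq_mul_div,
      div_le_iff₀ hV]
    have hε : 0 < ε ^ d := by positivity
    refine le_of_mul_le_mul_left ?_ hε
    linarith
  have h8 := mul_le_mul_of_nonneg_left (Real.exp_le_exp.1 h7) h0.le
  have e1 : ε * (s + (-(C / ε) + m / ε)) = s * ε - C + m := by field_simp; ring
  have e2 : ε * -(W ε q.2 / ε) = -W ε q.2 := by field_simp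
  rw [e1, e2] at h8
  linarith

theorem relaxedSup_mono (Ω : Set (Rn d)) (l : Filter ℝ) (W : ℝ → Rn d → ℝ) (x : Rn d) :
    Monotone (relaxedSup Ω l W x) := by
  intro r s hrs
  refine limsup_le_limsup (Eventually.of_forall fun ε => ?_)
  exact biSup_mono fun ξ hξ => ⟨Metric.ball_subset_ball hrs hξ.1, hξ.2⟩

/-- The half-relaxed upper limit exists and lies between two given real bounds. -/
theorem exists_tendsto_relaxedSup {Ω : Set (Rn d)} {l : Filter ℝ} [l.NeBot]
    {W : ℝ → Rn d → ℝ} {x : Rn d} {A B : ℝ}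
    (hB : ∃ r > 0, ∀ᶠ ε in l, ∀ ξ ∈ Metric.ball x r ∩ Ω, W ε ξ ≤ B)
    (hA : ∀ r > 0, ∀ᶠ ε in l, ∃ ξ ∈ Metric.ball x r ∩ Ω, A ≤ W ε ξ) :
    ∃ w : ℝ, Tendsto (fun r => relaxedSup Ω l W x r) (𝓝[>] 0) (𝓝 (w : EReal)) ∧
      A ≤ w ∧ w ≤ B := by
  have ht := (relaxedSup_mono Ω l W x).tendsto_nhdsGT 0
  set w := sInf (relaxedSup Ω l W x '' Ioi 0) with hw
  have hwB : w ≤ (B : EReal) := by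
    obtain ⟨r, hr, h⟩ := hB
    refine (sInf_le (mem_image_of_mem _ hr)).trans (limsup_le_of_le (h := ?_))
    filter_upwards [h] with ε hε
    exact iSup₂_le fun ξ hξ => EReal.coe_le_coe_iff.2 (hε ξ hξ)
  have hwA : (A : EReal) ≤ w := by
    refine le_sInf ?_
    rintro _ ⟨r, hr, rfl⟩
    refine le_limsup_of_frequently_le (Eventually.frequently ?_)
    filter_upwards [hA r hr] with ε hε
    obtain ⟨ξ, hξ, h⟩ := hε
    exact (EReal.coe_le_coe_iff.2 h).trans (le_iSup₂ (f := fun ξ _ => (W ε ξ : EReal)) ξ hξ)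
  have hco : (w.toReal : EReal) = w := EReal.coe_toReal
    (fun h => by rw [h, top_le_iff] at hwB; exact EReal.coe_ne_top _ hwB)
    (fun h => by rw [h, le_bot_iff] at hwA; exact EReal.coe_ne_bot _ hwA)
  refine ⟨w.toReal, by rw [hco]; exact ht, ?_, ?_⟩
  · rw [← hco] at hwA; exact EReal.coe_le_coe_iff.1 hwA
  · rw [← hco] at hwB; exact EReal.coe_le_coe_iff.1 hwB

end RelaxedLimit

end NonlocalSpectral

end

/-- The parameter `ε` tends to `0⁺` along an arbitrary filter `l ≤ 𝓝[>] 0`: `l = 𝓝[>] 0` gives the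
limit over all `ε`, and `l = map e atTop` the limit along a sequence `e n → 0⁺`. The half-relaxed
upper limit exists in `ℝ` at every point of `Ω`, and it is bounded in `Ω`. -/
theorem mainTheorem8 {d : ℕ} (hd : 1 ≤ d)
    (Ω Ω' : Set (NonlocalSpectral.Rn d))
    (hΩ : NonlocalSpectral.IsBoundedC1Domain Ω)
    (hΩ' : NonlocalSpectral.IsDomainIn Ω') (hsub : closure Ω' ⊆ Ω)
    (J : NonlocalSpectral.Rn d → ℝ) (hJ : NonlocalSpectral.IsDispersalKernel J)
    (κ : NonlocalSpectral.Rn d → NonlocalSpectral.Rn d → NonlocalSpectral.Rn d →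
      NonlocalSpectral.Rn d → ℝ)
    (hκ : NonlocalSpectral.IsAdmissibleKappa Ω κ)
    (a : NonlocalSpectral.Rn d → NonlocalSpectral.Rn d → ℝ)
    (ha : NonlocalSpectral.IsAdmissiblePotential Ω a)
    (l : Filter ℝ) (hl : l.NeBot) (hl0 : l ≤ 𝓝[>] (0 : ℝ))
    (W : ℝ → NonlocalSpectral.Rn d → ℝ)
    (hW : ∀ᶠ ε in l, NonlocalSpectral.IsLogEigenfunction Ω J κ a ε (W ε))
    (hmean : ∀ᶠ ε in l, ∫ x in Ω', W ε x = 0) :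
    ∃ Wstar : NonlocalSpectral.Rn d → ℝ,
      (∀ x ∈ Ω, Tendsto (fun r : ℝ => NonlocalSpectral.relaxedSup Ω l W x r) (𝓝[>] 0)
        (𝓝 (Wstar x : EReal))) ∧
      ∃ C : ℝ, ∀ x ∈ Ω, |Wstar x| ≤ C := by
  have hpos : ∀ᶠ ε in l, (0 : ℝ) < ε := hl0 self_mem_nhdsWithin
  have hb' : Bornology.IsBounded Ω' := hΩ.isBounded.subset (subset_closure.trans hsub)
  have hΩ'c : IsCompact (closure Ω') := hb'.isCompact_closure
  obtain ⟨b, ρ, hb, hρ, hSM⟩ := NonlocalSpectral.exists_isSuperMean hΩ hJ hκ ha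
  have hS : ∀ᶠ ε in l, NonlocalSpectral.IsSuperMean Ω b (ρ * ε)
      (fun y => Real.exp (-(W ε y / ε))) := by
    filter_upwards [hpos, hW] with ε h0 h1 using hSM ε h0 _ h1
  obtain ⟨C, hC⟩ := NonlocalSpectral.exists_eventually_le_of_le_ballMass hΩ.isOpen
    hΩ.exists_polyReach_le hb hρ hl0 hS
  have hV := NonlocalSpectral.volume_real_ball_pos (0 : NonlocalSpectral.Rn d) hρ
  have hvol : 0 < volume.real Ω' := ENNReal.toReal_pos
    (hΩ'.isOpen.measure_pos _ hΩ'.isConnected.nonempty).ne' hb'.measure_lt_top.ne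
  have hWint : ∀ᶠ ε in l, IntegrableOn (W ε) Ω' := by
    filter_upwards [hW] with ε h
    exact ((h.continuousOn.mono (hsub.trans subset_closure)).integrableOn_compact hΩ'c).mono_set
      subset_closure
  -- the mass of the eigenfunctions on `Ω'` is bounded below
  have hmass : ∀ᶠ ε in l, volume.real Ω' ≤ ∫ x in Ω', Real.exp (-(W ε x / ε)) := by
    filter_upwards [hWint, hmean, hS] with ε h1 h2 h3
    have hone : Integrable (fun _ => (1 : ℝ)) (volume.restrict Ω') :=
      integrableOn_const hb'.measure_lt_top.ne
    calc volume.real Ω' = ∫ x in Ω', (1 - W ε x / ε) := by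
          rw [integral_sub hone (h1.div_const ε), integral_div, h2]
          simp
      _ ≤ _ := by
          refine setIntegral_mono_on (hone.sub (h1.div_const ε))
            (h3.integrableOn.mono_set (subset_closure.trans hsub))
            hΩ'.isOpen.measurableSet fun x _ => ?_
          have := Real.add_one_le_exp (-(W ε x / ε))
          linarith
  obtain ⟨δ₀, hδ₀, hδΩ⟩ := hΩ'c.exists_cthickening_subset_open hΩ.isOpen hsub
  rw [Metric.cthickening_closure] at hδΩ
  set δ := δ₀ / 2 with hδ
  have hδ0 : 0 < δ := by positivity
  set S := Metric.thickening δ Ω' with hSdef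
  have hSc : S ⊆ Metric.cthickening δ Ω' := Metric.thickening_subset_cthickening _ _
  have hKS : IsCompact (Metric.cthickening δ Ω') :=
    Metric.isCompact_of_isClosed_isBounded Metric.isClosed_cthickening hb'.cthickening
  have hSvol : 0 < volume.real S := ENNReal.toReal_pos
    (Metric.isOpen_thickening.measure_pos _ (hΩ'.isConnected.nonempty.mono
      (Metric.self_subset_thickening hδ0 _))).ne' (hb'.thickening (δ := δ)).measure_lt_top.ne
  have hlarge : ∀ᶠ ε in l, ∃ z ∈ S,
      volume.real (Metric.ball (0 : NonlocalSpectral.Rn d) ρ) * volume.real Ω' / volume.real S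
        * ε ^ d * Real.exp (0 / ε)
      ≤ NonlocalSpectral.ballMass (fun y => Real.exp (-(W ε y / ε))) (ρ * ε) z := by
    filter_upwards [hmass, hS, hpos, (NonlocalSpectral.tendsto_const_mul_zero hl0 ρ).eventually
      (gt_mem_nhds hδ0)] with ε h1 h2 h0 h3
    obtain ⟨z, hz, hle⟩ := NonlocalSpectral.exists_le_ballMass hΩ'.isOpen
      hΩ'.isConnected.nonempty hb' h2.integrableOn h2.pos (by positivity) h3.le
      ((Metric.thickening_subset_cthickening _ _).trans
        (by rw [hδ, mul_div_cancel₀ _ two_ne_zero]; exact hδΩ))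
    refine ⟨z, hz, ?_⟩
    rw [zero_div, Real.exp_zero, mul_one, div_mul_eq_mul_div, div_le_iff₀ hSvol,
      mul_comm (NonlocalSpectral.ballMass _ _ _)]
    refine le_trans ?_ hle
    rw [NonlocalSpectral.volume_real_ball_mul ρ h0]
    have h4 := mul_le_mul_of_nonneg_left h1
      (show 0 ≤ ε ^ d * volume.real (Metric.ball (0 : NonlocalSpectral.Rn d) ρ) by positivity)
    linarith
  have hpt : ∀ x ∈ Ω, ∃ w : ℝ,
      Tendsto (fun r : ℝ => NonlocalSpectral.relaxedSup Ω l W x r) (𝓝[>] 0) (𝓝 (w : EReal)) ∧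
        -(C + 2) ≤ w ∧ w ≤ C + 1 := by
    intro x hx
    refine NonlocalSpectral.exists_tendsto_relaxedSup ?_ fun r hr => ?_
    · obtain ⟨r, hr, hrΩ⟩ := Metric.nhds_basis_closedBall.mem_iff.1 (hΩ.isOpen.mem_nhds hx)
      refine ⟨r, hr, ?_⟩
      filter_upwards [hlarge, hC (Metric.cthickening δ Ω' ×ˢ Metric.closedBall x r)
        (hKS.prod (isCompact_closedBall x r))
        (prod_mono ((Metric.cthickening_mono (by linarith) _).trans hδΩ) hrΩ) _ 0
        (div_pos (mul_pos hV hvol) hSvol)] with ε h1 h2 ξ hξ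
      obtain ⟨z, hz, hle⟩ := h1
      have := h2 (z, ξ) ⟨hSc hz, Metric.ball_subset_closedBall hξ.1⟩ hle
      linarith
    · filter_upwards [hC ({x} ×ˢ closure Ω') (isCompact_singleton.prod hΩ'c)
        (prod_mono (singleton_subset_iff.2 hx) hsub) _ (C + 2) hV, hS, hpos, hWint, hmean,
        (NonlocalSpectral.tendsto_const_mul_zero hl0 ρ).eventually (gt_mem_nhds hr),
        NonlocalSpectral.eventually_ball_subset_of_isCompact hΩ.isOpen isCompact_singleton
          (singleton_subset_iff.2 hx) hl0 ρ] with ε h1 h2 h0 h3 h4 h5 h6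
      by_contra! hlt
      have hsubΩ := h6 x rfl
      have hm : volume.real (Metric.ball (0 : NonlocalSpectral.Rn d) ρ) * ε ^ d
          * Real.exp ((C + 2) / ε)
          ≤ NonlocalSpectral.ballMass (fun y => Real.exp (-(W ε y / ε))) (ρ * ε) x := by
        have h7 := setIntegral_mono_on (μ := volume)
          (integrableOn_const (C := Real.exp ((C + 2) / ε)) measure_ball_lt_top.ne)
          (h2.integrableOn.mono_set hsubΩ) measurableSet_ball (fun y hy => by
            have h8 := hlt y ⟨Metric.ball_subset_ball h5.le hy, hsubΩ hy⟩
            rw [Real.exp_le_exp, ← neg_div]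
            gcongr
            linarith)
        rw [setIntegral_const, smul_eq_mul, NonlocalSpectral.volume_real_ball,
          NonlocalSpectral.volume_real_ball_mul ρ h0] at h7
        refine le_trans (le_of_eq ?_) h7
        ring
      have h9 := setIntegral_mono_on (μ := volume) h3
        (integrableOn_const (C := (-1 : ℝ)) hb'.measure_lt_top.ne) hΩ'.isOpen.measurableSet
        (fun y hy => by
          have := h1 (x, y) ⟨rfl, subset_closure hy⟩ hm
          simp only at this
          linarith)
      rw [h4, setIntegral_const, smul_eq_mul] at h9
      linarith
  choose! w hw using hpt
  refine ⟨w, fun x hx => (hw x hx).1, |C| + 2, fun x hx => abs_le.2 ⟨?_, ?_⟩⟩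
  · linarith [(hw x hx).2.1, le_abs_self C]
  · linarith [(hw x hx).2.2, le_abs_self C]
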